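/- Let $(X,\nu)$ be an atomless probability space, that is, every measurable set of positive measure has a measurable subset of strictly smaller positive measure. Let $\Gamma$ be a free group of rank $r\ge 1$ with free generating set $\{a_1,\dots,a_r\}$, acting on $(X,\nu)$ by measure-preserving transformations (transformations which agree almost everywhere being identified). Let $q=2r-1$, and for an integer $n\ge 0$ let $S_n$ and $B_n$ be the sphere and the ball of $\Gamma$ of radius $n$ around the identity, with respect to the word metric defined by $S=\{a_1^{\pm1},\dots,a_r^{\pm1}\}$. Then for every $n\ge 0$ \[ \sup_{\|f\|_2=1}\left\|\frac1{|S_n|}\sum_{\gamma\in S_n}f(\gamma x)-\int_X f(y)\,d\nu(y)\right\|_2\ \ge\ \left(1+\frac{q-1}{q+1}\,n\right)q^{-n/2}, \] \[ \sup_{\|f\|_2=1}\left\|\frac1{|B_n|}\sum_{\gamma\in B_n}f(\gamma x)-\int_X f(y)\,d\nu(y)\right\|_2\ \ge\ c(q,n)\left(1+\left(1+\frac1{\sqrt q}\right)n\right)q^{-n/2}, \] where $c(q,n)=\left(1+2q^{-n}\sum_{k=0}^{n-1}q^k\right)^{-1}$, the suprema run over all complex-valued $f\in L^2(X,\nu)$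 of norm $1$, and the outer norms are $L^2(X,\nu)$-norms of functions of $x$. -/

import Mathlib

open MeasureTheory
open scoped ENNReal

/-- A measure is atomless if every measurable set of positive measure has a measurable subset of
strictly smaller positive measure. (This is stronger in general than Mathlib's `NullSingletonClass`, which only
asks that points have measure zero.) -/
def IsAtomless {X : Type*} [MeasurableSpace X] (ν : Measure X) : Prop :=
  ∀ A : Set X, MeasurableSet A → 0 < ν A →
    ∃ B : Set X, B ⊆ A ∧ MeasurableSet B ∧ 0 < ν B ∧ ν B < ν A

/-- `T : Γ → X → X` is an action of the group `Γ` on `(X, ν)` by measure-preserving transformations.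
As usual in ergodic theory, transformations which agree almost everywhere are identified, so the
laws of an action are required almost everywhere; each `T γ` is then invertible almost everywhere,
with inverse `T γ⁻¹`. Pointwise actions are a special case, see
`isMeasurePreservingAction_smul`. -/
structure IsMeasurePreservingAction {Γ X : Type*} [Group Γ] [MeasurableSpace X]
    (ν : Measure X) (T : Γ → X → X) : Prop where
  measurePreserving : ∀ γ, MeasurePreserving (T γ) ν ν
  map_one : T 1 =ᵐ[ν] id
  map_mul : ∀ γ δ, T (γ * δ) =ᵐ[ν] T γ ∘ T δ

theorem isMeasurePreservingAction_smul {Γ X : Type*} [Group Γ] [MeasurableSpace X]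
    (ν : Measure X) [MulAction Γ X] [MeasurableConstSMul Γ X] [SMulInvariantMeasure Γ X ν] :
    IsMeasurePreservingAction ν (fun (γ : Γ) (x : X) => γ • x) where
  measurePreserving γ := measurePreserving_smul γ ν
  map_one := Filter.Eventually.of_forall fun x => one_smul Γ x
  map_mul γ δ := Filter.Eventually.of_forall fun x => mul_smul γ δ x

/-- The word length of `g` with respect to `S`: the least length of a word in the elements of `S`
with product `g` (`⊤` if there is none). It is the distance from `1` to `g` in the word metric
defined by `S`, when `S = S⁻¹` generates the group. -/
noncomputable def wordLength {Γ : Type*} [Group Γ] (S : Set Γ) (g : Γ) : ℕ∞ :=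
  ⨅ l ∈ {l : List Γ | (∀ s ∈ l, s ∈ S) ∧ l.prod = g}, (l.length : ℕ∞)

/-- The sphere of radius `n` around `1` for the word metric defined by `S`. -/
def wordSphere {Γ : Type*} [Group Γ] (S : Set Γ) (n : ℕ) : Set Γ := {g | wordLength S g = n}

/-- The ball of radius `n` around `1` for the word metric defined by `S`. -/
def wordBall {Γ : Type*} [Group Γ] (S : Set Γ) (n : ℕ) : Set Γ := {g | wordLength S g ≤ n}

theorem exists_word_of_wordLength_le {Γ : Type*} [Group Γ] {S : Set Γ} {n : ℕ} {g : Γ}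
    (h : wordLength S g ≤ n) :
    ∃ l : List Γ, (∀ s ∈ l, s ∈ S) ∧ l.prod = g ∧ l.length ≤ n := by
  by_contra! H
  have h1 : ((n + 1 : ℕ) : ℕ∞) ≤ wordLength S g :=
    le_iInf₂ fun l hl => by exact_mod_cast H l hl.1 hl.2
  have h2 : ((n + 1 : ℕ) : ℕ∞) ≤ (n : ℕ) := h1.trans h
  have h3 : n + 1 ≤ n := by exact_mod_cast h2
  omega

theorem finite_wordBall {Γ : Type*} [Group Γ] {S : Set Γ} (hS : S.Finite) (n : ℕ) :
    (wordBall S n).Finite := by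
  have := hS.to_subtype
  refine ((List.finite_length_le S n).image
    fun l : List S => (l.map Subtype.val).prod).subset fun g hg => ?_
  obtain ⟨l, hl, hp, hn⟩ := exists_word_of_wordLength_le hg
  lift l to List S using hl
  exact ⟨l, by simpa using hn, hp⟩

theorem finite_wordSphere {Γ : Type*} [Group Γ] {S : Set Γ} (hS : S.Finite) (n : ℕ) :
    (wordSphere S n).Finite :=
  (finite_wordBall hS n).subset fun _ hg => le_of_eq hg

/-- The symmetric generating set `{a₁^{±1}, …, aᵣ^{±1}}` of a free group with basis
`a₁, …, aᵣ`. -/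
def symmGenerators {Γ : Type*} [Group Γ] {r : ℕ} (a : FreeGroupBasis (Fin r) Γ) : Set Γ :=
  Set.range (fun i => a i) ∪ Set.range (fun i => (a i)⁻¹)

theorem finite_symmGenerators {Γ : Type*} [Group Γ] {r : ℕ} (a : FreeGroupBasis (Fin r) Γ) :
    (symmGenerators a).Finite :=
  (Set.finite_range _).union (Set.finite_range _)

/-- The sphere `Sₙ` around `1` in a free group, for the word metric of a free basis. -/
noncomputable def freeSphere {Γ : Type*} [Group Γ] {r : ℕ} (a : FreeGroupBasis (Fin r) Γ)
    (n : ℕ) : Finset Γ :=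
  (finite_wordSphere (finite_symmGenerators a) n).toFinset

/-- The ball `Bₙ` around `1` in a free group, for the word metric of a free basis. -/
noncomputable def freeBall {Γ : Type*} [Group Γ] {r : ℕ} (a : FreeGroupBasis (Fin r) Γ)
    (n : ℕ) : Finset Γ :=
  (finite_wordBall (finite_symmGenerators a) n).toFinset

/-- The discrepancy of a finite set `E ⊆ Γ` acting on `(X, ν)` through `T`: the supremum, over
all complex `f ∈ L²(X, ν)` with `‖f‖₂ = 1`, of
`‖x ↦ |E|⁻¹ ∑_{γ ∈ E} f (γ x) - ∫ f dν‖₂`. -/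
noncomputable def discrepancy {Γ X : Type*} [MeasurableSpace X] (ν : Measure X)
    (T : Γ → X → X) (E : Finset Γ) : ℝ≥0∞ :=
  ⨆ f ∈ {f : X → ℂ | MemLp f 2 ν ∧ eLpNorm f 2 ν = 1},
    eLpNorm (fun x => (1 / (E.card : ℂ)) * ∑ γ ∈ E, f (T γ x) - ∫ y, f y ∂ν) 2 ν

/-- The constant `c(q, n) = (1 + 2 q^{-n} ∑_{k=0}^{n-1} q^k)⁻¹`. -/
noncomputable def ballConst (q : ℝ) (n : ℕ) : ℝ :=
  (1 + 2 * q ^ (-(n : ℤ)) * ∑ k ∈ Finset.range n, q ^ k)⁻¹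

/-!
The lower bound has two halves.

*In every measure-preserving action of a group `Γ` on an atomless probability space, the discrepancy
is at least the norm in the regular representation.* Let `μ` be the uniform measure on a finite
symmetric set `E ⊆ Γ`, let `D` be its discrepancy, and let `x` be a non-negative finitely supported
function on `Γ`. Let `A ⊆ X` have small measure, and let `f` be the sum of the translates of `1_A`
with weights `x`. Since translates of `1_A` have non-negative inner products,
`⟨μᵐ f, f⟩ ≥ ν(A) ⟨μᵐ x, x⟩`, the inner product on the right being that of `ℓ²(Γ)`; freeness of the
action is not needed. On the other hand `‖f‖²` is `O(ν(A))`, and the mean of `f` is also `O(ν(A))`,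
so that its square is negligible. Iterating `‖μ f‖ ≤ D ‖f‖` on functions of mean zero and letting
`ν(A)` tend to `0` gives `⟨μᵐ x, x⟩ ≤ K Dᵐ` with `K` independent of `m`
(`IsMeasurePreservingAction.exists_forall_pairing_pow_le`). As `μ` is self-adjoint,
Cauchy-Schwarz turns this into `⟨μ x, x⟩ ≤ D ⟨x, x⟩`
(`MonoidAlgebra.pairing_mul_le_of_forall_pow`).

*The norm of a sphere or a ball in the regular representation of the free group.* Take for `x` the
radial function `q ^ (-|γ| / 2)`, truncated at radius `N + 1`. Up to an error bounded in `ℓ²(Γ)`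
independently of `N`, it is an eigenfunction of the indicator function `σ₁` of the sphere of radius
`1`, with eigenvalue `2 √q`, whereas its norm tends to infinity. The recursion
`σ₁ σₙ = σₙ₊₁ + q σₙ₋₁` for `n ≥ 2` (`q + 1` in place of `q` for `n = 1`) extends this to all
spheres (`FreeGroupBasis.sphereElt_mul_testElt_mem_bounded`), and summation extends it to balls.
Division of the eigenvalues by the number of elements gives the two bounds; the eigenvalue of the
ball is computed in `FreeGroupBasis.sum_sphereEigenvalue`.
-/

/-! ### Small sets and the Koopman representation -/

/-- Splitting a set into two pieces and keeping the lighter one halves the measure, so an atomless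
probability space has sets of arbitrarily small positive measure. -/
theorem IsAtomless.exists_measure_lt {X : Type*} [MeasurableSpace X] {ν : Measure X}
    [IsProbabilityMeasure ν] (hν : IsAtomless ν) {ε : ℝ≥0∞} (hε : ε ≠ 0) :
    ∃ A : Set X, MeasurableSet A ∧ 0 < ν A ∧ ν A < ε := by
  have halving : ∀ k : ℕ, ∃ A : Set X, MeasurableSet A ∧ 0 < ν A ∧ ν A ≤ 2⁻¹ ^ k := by
    intro k
    induction k with
    | zero => exact ⟨Set.univ, .univ, by simp, by simp⟩
    | succ k ih =>
      obtain ⟨A, hA, hpos, hle⟩ := ih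
      obtain ⟨B, hBA, hB, hBpos, hBlt⟩ := hν A hA hpos
      have hsum : ν B + ν (A \ B) = ν A := by
        rw [← measure_inter_add_sdiff A hB, Set.inter_eq_self_of_subset_right hBA]
      have key : ∀ C : Set X, ν C + ν C ≤ ν A → ν C ≤ 2⁻¹ ^ (k + 1) := by
        intro C hC
        rw [pow_succ, ← div_eq_mul_inv,
          ENNReal.le_div_iff_mul_le (Or.inl (by simp)) (Or.inl (by simp)), mul_two]
        exact hC.trans hle
      rcases le_total (ν B) (ν (A \ B)) with h | h
      · exact ⟨B, hB, hBpos, key B (by rw [← hsum]; gcongr)⟩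
      · refine ⟨A \ B, hA.diff hB, ?_, key _ (by rw [← hsum]; gcongr)⟩
        rw [pos_iff_ne_zero]
        intro h0
        rw [h0, add_zero] at hsum
        exact hBlt.ne hsum
  obtain ⟨k, hk⟩ := ENNReal.exists_inv_two_pow_lt hε
  obtain ⟨A, hA, hpos, hle⟩ := halving k
  exact ⟨A, hA, hpos, hle.trans_lt hk⟩

namespace IsMeasurePreservingAction

variable {Γ X : Type*} [Group Γ] [MeasurableSpace X] {ν : Measure X} {T : Γ → X → X}

/-- The Koopman representation of `Γ` on the real Hilbert space `L²(X, ν)`: `γ` acts by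
`f ↦ f ∘ T γ⁻¹`. The laws of `T` hold only almost everywhere, which is enough in `L²`. -/
noncomputable def koopman (hT : IsMeasurePreservingAction ν T) :
    Γ →* Module.End ℝ (Lp ℝ 2 ν) where
  toFun γ := (Lp.compMeasurePreservingₗᵢ ℝ (T γ⁻¹) (hT.measurePreserving γ⁻¹)).toLinearMap
  map_one' := by
    ext1 f
    apply Lp.ext
    refine (Lp.coeFn_compMeasurePreserving f (hT.measurePreserving 1⁻¹)).trans ?_
    filter_upwards [hT.map_one] with x hx
    simp [hx]
  map_mul' γ δ := by
    ext1 f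
    apply Lp.ext
    refine (Lp.coeFn_compMeasurePreserving f (hT.measurePreserving (γ * δ)⁻¹)).trans ?_
    refine .trans ?_ (Lp.coeFn_compMeasurePreserving
      (Lp.compMeasurePreserving (T δ⁻¹) (hT.measurePreserving δ⁻¹) f)
      (hT.measurePreserving γ⁻¹)).symm
    have h := (hT.measurePreserving γ⁻¹).quasiMeasurePreserving.ae_eq_comp
      (Lp.coeFn_compMeasurePreserving f (hT.measurePreserving δ⁻¹))
    filter_upwards [hT.map_mul δ⁻¹ γ⁻¹, h] with x hx hx'
    rw [hx']
    simp [mul_inv_rev, hx]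

theorem coeFn_koopman (hT : IsMeasurePreservingAction ν T) (γ : Γ) (f : Lp ℝ 2 ν) :
    hT.koopman γ f =ᵐ[ν] f ∘ T γ⁻¹ :=
  Lp.coeFn_compMeasurePreserving f (hT.measurePreserving γ⁻¹)

theorem norm_koopman (hT : IsMeasurePreservingAction ν T) (γ : Γ) (f : Lp ℝ 2 ν) :
    ‖hT.koopman γ f‖ = ‖f‖ :=
  Lp.norm_compMeasurePreserving f (hT.measurePreserving γ⁻¹)

theorem inner_koopman_koopman (hT : IsMeasurePreservingAction ν T) (γ : Γ) (f g : Lp ℝ 2 ν) :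
    inner ℝ (hT.koopman γ f) (hT.koopman γ g) = inner ℝ f g :=
  (Lp.compMeasurePreservingₗᵢ ℝ (T γ⁻¹) (hT.measurePreserving γ⁻¹)).inner_map_map f g

theorem koopman_const [IsProbabilityMeasure ν] (hT : IsMeasurePreservingAction ν T) (γ : Γ)
    (c : ℝ) : hT.koopman γ (Lp.const 2 ν c) = Lp.const 2 ν c := by
  apply Lp.ext
  refine (hT.coeFn_koopman γ _).trans ?_
  have h := (hT.measurePreserving γ⁻¹).quasiMeasurePreserving.ae_eq_comp
    (Lp.coeFn_const (p := 2) (μ := ν) c)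
  filter_upwards [h, Lp.coeFn_const (p := 2) (μ := ν) c] with x hx hx'
  rw [hx, hx']
  rfl

end IsMeasurePreservingAction

/-! ### The group algebra as a subspace of `ℓ²(Γ)` -/

namespace MonoidAlgebra

section Pairing

variable {Γ : Type*}

/-- The inner product of `ℓ²(Γ)`, restricted to the finitely supported functions: the sum of
`x g * y g` over `g`. -/
noncomputable def pairing : LinearMap.BilinForm ℝ (MonoidAlgebra ℝ Γ) :=
  (Finsupp.linearCombination ℝ fun g : Γ =>
    (Finsupp.lapply g).comp (coeffLinearEquiv (M := Γ) (S := ℝ) ℝ).toLinearMap).comp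
      (coeffLinearEquiv (M := Γ) (S := ℝ) ℝ).toLinearMap

theorem pairing_apply (x y : MonoidAlgebra ℝ Γ) :
    pairing x y = x.coeff.sum fun g a => a * y.coeff g := by
  simp [pairing, Finsupp.linearCombination_apply, Finsupp.sum, coeffLinearEquiv]

theorem pairing_single_left (g : Γ) (a : ℝ) (y : MonoidAlgebra ℝ Γ) :
    pairing (single g a) y = a * y.coeff g := by
  simp [pairing_apply]

theorem pairing_comm (x y : MonoidAlgebra ℝ Γ) : pairing x y = pairing y x := by
  classical
  rw [pairing_apply, pairing_apply,
    Finsupp.sum_of_support_subset _ (Finset.subset_union_left (s₂ := y.coeff.support)) _ (by simp),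
    Finsupp.sum_of_support_subset _ (Finset.subset_union_right (s₁ := x.coeff.support)) _ (by simp)]
  exact Finset.sum_congr rfl fun g _ => mul_comm _ _

theorem pairing_self_nonneg (x : MonoidAlgebra ℝ Γ) : 0 ≤ pairing x x := by
  rw [pairing_apply]
  exact Finset.sum_nonneg fun g _ => mul_self_nonneg _

theorem pairing_sq_le (x y : MonoidAlgebra ℝ Γ) :
    pairing x y ^ 2 ≤ pairing x x * pairing y y :=
  pairing.apply_sq_le_of_symm pairing_self_nonneg ⟨pairing_comm⟩ x y

/-- The indicator function of `E`, as an element of the group algebra. -/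
noncomputable def indicator (E : Finset Γ) : MonoidAlgebra ℝ Γ := ∑ g ∈ E, single g 1

theorem coeff_indicator [DecidableEq Γ] (E : Finset Γ) (g : Γ) :
    (indicator E).coeff g = if g ∈ E then 1 else 0 := by
  simp [indicator, coeff_sum, Finsupp.single_apply]

theorem pairing_indicator_left (E : Finset Γ) (y : MonoidAlgebra ℝ Γ) :
    pairing (indicator E) y = ∑ g ∈ E, y.coeff g := by
  simp [indicator, pairing_single_left]

/-- The uniform probability measure on `E`, as an element of the group algebra. -/
noncomputable def uniform (E : Finset Γ) : MonoidAlgebra ℝ Γ :=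
  (E.card : ℝ)⁻¹ • indicator E

end Pairing

section Group

variable {Γ : Type*} [Group Γ]

/-- The adjoint of left translation by `g` is left translation by `g⁻¹`. -/
theorem pairing_single_mul (g : Γ) (a : ℝ) (x y : MonoidAlgebra ℝ Γ) :
    pairing (single g a * x) y = pairing x (single g⁻¹ a * y) := by
  induction x using MonoidAlgebra.induction_linear with
  | zero => simp
  | add x₁ x₂ h₁ h₂ => simp [mul_add, h₁, h₂]
  | single h b =>
    rw [single_mul_single, pairing_single_left, pairing_single_left, coeff_single_mul_apply,
      inv_inv]
    ring

theorem pairing_indicator_mul {E : Finset Γ} (hE : ∀ g ∈ E, g⁻¹ ∈ E) (x y : MonoidAlgebra ℝ Γ) :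
    pairing (indicator E * x) y = pairing x (indicator E * y) := by
  simp only [indicator, Finset.sum_mul, map_sum, LinearMap.sum_apply, pairing_single_mul]
  exact Finset.sum_nbij' (·⁻¹) (·⁻¹) hE hE (by simp) (by simp) (by simp)

theorem coeff_uniform_pow_mul_nonneg (E : Finset Γ) {x : MonoidAlgebra ℝ Γ}
    (hx : ∀ g, 0 ≤ x.coeff g) (m : ℕ) (g : Γ) : 0 ≤ (uniform E ^ m * x).coeff g := by
  induction m generalizing g with
  | zero => simpa using hx g
  | succ m ih =>
    rw [pow_succ', mul_assoc, uniform, indicator, smul_mul_assoc, Finset.sum_mul, coeff_smul,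
      Finsupp.smul_apply, coeff_sum, Finsupp.finsetSum_apply]
    refine smul_nonneg (by positivity) (Finset.sum_nonneg fun h _ => ?_)
    rw [coeff_single_mul_apply, one_mul]
    exact ih _

/-- For a self-adjoint operator, the exponential growth rate of the moments `⟨uᵐ x, x⟩` is at least
the Rayleigh quotient `⟨u x, x⟩ / ⟨x, x⟩`. Only the moments of order `2 ^ j` are used, for which the
estimate is the Cauchy-Schwarz inequality, applied `j` times. -/
theorem pairing_mul_le_of_forall_pow {u x : MonoidAlgebra ℝ Γ} {K D : ℝ} (hD : 0 ≤ D)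
    (hu : ∀ y z, pairing (u * y) z = pairing y (u * z))
    (h : ∀ m : ℕ, pairing (u ^ m * x) x ≤ K * D ^ m) :
    pairing (u * x) x ≤ D * pairing x x := by
  by_contra! hlt
  have hx0 := pairing_self_nonneg x
  have hxpos : 0 < pairing x x := by
    refine hx0.lt_of_ne' fun h0 => ?_
    have := pairing_sq_le (u * x) x
    rw [h0, mul_zero] at this
    rw [h0, mul_zero] at hlt
    nlinarith
  set ρ := pairing (u * x) x / pairing x x with hρ
  have hDρ : D < ρ := by rwa [hρ, lt_div_iff₀ hxpos]
  have hρpos : 0 < ρ := hD.trans_lt hDρ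
  have hupow : ∀ (m : ℕ) (y z), pairing (u ^ m * y) z = pairing y (u ^ m * z) := by
    intro m
    induction m with
    | zero => simp
    | succ m ih =>
      intro y z
      rw [pow_succ, mul_assoc, ih, hu, ← mul_assoc, ← pow_succ', pow_succ]
  have hlow : ∀ j : ℕ, ρ ^ 2 ^ j * pairing x x ≤ pairing (u ^ 2 ^ j * x) x := by
    intro j
    induction j with
    | zero => simp [hρ, div_mul_cancel₀ _ hxpos.ne']
    | succ j ih =>
      have h2 : pairing (u ^ 2 ^ (j + 1) * x) x = pairing (u ^ 2 ^ j * x) (u ^ 2 ^ j * x) := by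
        rw [← hupow (2 ^ j) (u ^ 2 ^ j * x) x, ← mul_assoc, ← pow_add, ← two_mul, ← pow_succ']
      have h3 := pairing_sq_le (u ^ 2 ^ j * x) x
      rw [← h2] at h3
      refine le_of_mul_le_mul_right (le_trans ?_ h3) hxpos
      calc ρ ^ 2 ^ (j + 1) * pairing x x * pairing x x
          = (ρ ^ 2 ^ j * pairing x x) ^ 2 := by rw [pow_succ 2 j, pow_mul]; ring
        _ ≤ _ := by gcongr
  -- If the Rayleigh quotient `ρ` exceeded `D`, then `K (D / ρ) ^ (2 ^ j)` would tend to `0`,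
  -- although it is at least `⟨x, x⟩`.
  have hlim : Filter.Tendsto (fun j : ℕ => K * (D / ρ) ^ 2 ^ j) Filter.atTop (nhds (K * 0)) :=
    ((tendsto_pow_atTop_nhds_zero_of_lt_one (div_nonneg hD hρpos.le)
      ((div_lt_one hρpos).2 hDρ)).comp
        (tendsto_pow_atTop_atTop_of_one_lt one_lt_two)).const_mul K
  refine hxpos.not_ge ((ge_of_tendsto' hlim fun j => ?_).trans_eq (mul_zero K))
  rw [div_pow, mul_div_assoc', le_div_iff₀ (pow_pos hρpos _), mul_comm]
  exact (hlow j).trans (h _)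

end Group

end MonoidAlgebra

/-! ### Discrepancy and Rayleigh quotients in `ℓ²(Γ)` -/

namespace IsMeasurePreservingAction

variable {Γ X : Type*} [Group Γ] [MeasurableSpace X] {ν : Measure X} {T : Γ → X → X}

/-- The Koopman representation, extended linearly to the group algebra. -/
noncomputable def algKoopman (hT : IsMeasurePreservingAction ν T) :
    MonoidAlgebra ℝ Γ →ₐ[ℝ] Module.End ℝ (Lp ℝ 2 ν) :=
  MonoidAlgebra.lift ℝ (Module.End ℝ (Lp ℝ 2 ν)) Γ hT.koopman

theorem algKoopman_apply (hT : IsMeasurePreservingAction ν T) (x : MonoidAlgebra ℝ Γ)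
    (f : Lp ℝ 2 ν) : hT.algKoopman x f = x.coeff.sum fun g a => a • hT.koopman g f := by
  simp [algKoopman, MonoidAlgebra.lift_apply, Finsupp.sum, LinearMap.sum_apply]

theorem norm_algKoopman_le (hT : IsMeasurePreservingAction ν T) (x : MonoidAlgebra ℝ Γ)
    (f : Lp ℝ 2 ν) : ‖hT.algKoopman x f‖ ≤ (x.coeff.sum fun _ a => |a|) * ‖f‖ := by
  rw [algKoopman_apply, Finsupp.sum, Finsupp.sum, Finset.sum_mul]
  refine (norm_sum_le _ _).trans (Finset.sum_le_sum fun g _ => ?_)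
  rw [norm_smul, norm_koopman, Real.norm_eq_abs]

theorem algKoopman_indicator (hT : IsMeasurePreservingAction ν T) (E : Finset Γ) (f : Lp ℝ 2 ν) :
    hT.algKoopman (MonoidAlgebra.indicator E) f = ∑ g ∈ E, hT.koopman g f := by
  simp [algKoopman, MonoidAlgebra.indicator, LinearMap.sum_apply]

/-- Any two translates of the indicator function of `A` have non-negative inner product. This
replaces the orthogonality that a free action would offer for suitable `A`. -/
theorem inner_koopman_indicator_nonneg (hT : IsMeasurePreservingAction ν T) {A : Set X}
    (hA : MeasurableSet A) (hνA : ν A ≠ ∞) (g h : Γ) :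
    0 ≤ (inner ℝ (hT.koopman g (indicatorConstLp 2 hA hνA (1 : ℝ)))
      (hT.koopman h (indicatorConstLp 2 hA hνA (1 : ℝ))) : ℝ) := by
  have pos : ∀ g, ∀ᵐ x ∂ν, 0 ≤ hT.koopman g (indicatorConstLp 2 hA hνA (1 : ℝ)) x := by
    intro g
    have h := (hT.measurePreserving g⁻¹).quasiMeasurePreserving.ae_eq_comp
      (indicatorConstLp_coeFn (p := 2) (hs := hA) (hμs := hνA) (c := (1 : ℝ)))
    filter_upwards [hT.coeFn_koopman g (indicatorConstLp 2 hA hνA (1 : ℝ)), h] with x hx hx'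
    rw [hx, hx']
    exact Set.indicator_nonneg (fun _ _ => zero_le_one) _
  rw [L2.inner_def]
  refine integral_nonneg_of_ae ?_
  filter_upwards [pos g, pos h] with x hg hh
  simpa using mul_nonneg hh hg

theorem inner_indicator_self {A : Set X} (hA : MeasurableSet A) (hνA : ν A ≠ ∞) :
    (inner ℝ (indicatorConstLp 2 hA hνA (1 : ℝ)) (indicatorConstLp 2 hA hνA (1 : ℝ)) : ℝ)
      = ν.real A := by
  rw [real_inner_self_eq_norm_sq, norm_indicatorConstLp (by simp) (by simp), norm_one, one_mul,
    ← Real.rpow_natCast, ← Real.rpow_mul measureReal_nonneg]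
  norm_num

/-- For non-negative `x` and `y`, the inner product in `L²(X, ν)` of the functions obtained from
`1_A` dominates `ν(A)` times the inner product in `ℓ²(Γ)`: the diagonal terms give exactly the
latter and the others are non-negative. -/
theorem pairing_le_inner_algKoopman (hT : IsMeasurePreservingAction ν T) {A : Set X}
    (hA : MeasurableSet A) (hνA : ν A ≠ ∞) {x y : MonoidAlgebra ℝ Γ}
    (hx : ∀ g, 0 ≤ x.coeff g) (hy : ∀ g, 0 ≤ y.coeff g) :
    ν.real A * MonoidAlgebra.pairing x y ≤
      inner ℝ (hT.algKoopman x (indicatorConstLp 2 hA hνA (1 : ℝ)))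
        (hT.algKoopman y (indicatorConstLp 2 hA hνA (1 : ℝ))) := by
  classical
  simp only [algKoopman_apply, MonoidAlgebra.pairing_apply, Finsupp.sum, sum_inner, inner_sum,
    inner_smul_left, inner_smul_right, Finset.mul_sum]
  rw [Finset.sum_comm]
  refine Finset.sum_le_sum fun g hg => ?_
  have hnn : ∀ h ∈ y.coeff.support, 0 ≤ y.coeff h * (x.coeff g *
      (inner ℝ (hT.koopman g (indicatorConstLp 2 hA hνA (1 : ℝ)))
        (hT.koopman h (indicatorConstLp 2 hA hνA (1 : ℝ))) : ℝ)) := fun h _ =>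
    mul_nonneg (hy h) (mul_nonneg (hx g) (hT.inner_koopman_indicator_nonneg hA hνA g h))
  -- Only the term `h = g` is kept.
  by_cases hgy : g ∈ y.coeff.support
  · refine le_trans (le_of_eq ?_) (Finset.single_le_sum hnn hgy)
    rw [inner_koopman_koopman, inner_indicator_self]
    ring
  · rw [Finsupp.notMem_support_iff.1 hgy]
    simpa using Finset.sum_nonneg hnn

theorem inner_koopman_const [IsProbabilityMeasure ν] (hT : IsMeasurePreservingAction ν T) (g : Γ)
    (f : Lp ℝ 2 ν) :
    (inner ℝ (hT.koopman g f) (Lp.const 2 ν (1 : ℝ)) : ℝ) = inner ℝ f (Lp.const 2 ν (1 : ℝ)) := by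
  conv_lhs => rw [← hT.koopman_const g, inner_koopman_koopman]

theorem inner_const [IsProbabilityMeasure ν] (f : Lp ℝ 2 ν) :
    (inner ℝ f (Lp.const 2 ν (1 : ℝ)) : ℝ) = ∫ x, f x ∂ν := by
  rw [L2.inner_def]
  exact integral_congr_ae (.of_forall fun x => by simp)

theorem algKoopman_uniform_const [IsProbabilityMeasure ν] (hT : IsMeasurePreservingAction ν T)
    {E : Finset Γ} (hne : E.Nonempty) :
    hT.algKoopman (MonoidAlgebra.uniform E) (Lp.const 2 ν (1 : ℝ)) = Lp.const 2 ν (1 : ℝ) := by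
  have hE : (E.card : ℝ) ≠ 0 := by exact_mod_cast hne.card_ne_zero
  rw [MonoidAlgebra.uniform, map_smul, LinearMap.smul_apply, algKoopman_indicator]
  simp only [koopman_const, Finset.sum_const]
  rw [← Nat.cast_smul_eq_nsmul ℝ, smul_smul, inv_mul_cancel₀ hE, one_smul]

theorem inner_algKoopman_uniform_const [IsProbabilityMeasure ν]
    (hT : IsMeasurePreservingAction ν T) {E : Finset Γ} (hne : E.Nonempty) (f : Lp ℝ 2 ν) :
    (inner ℝ (hT.algKoopman (MonoidAlgebra.uniform E) f) (Lp.const 2 ν (1 : ℝ)) : ℝ) =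
      inner ℝ f (Lp.const 2 ν (1 : ℝ)) := by
  have hE : (E.card : ℝ) ≠ 0 := by exact_mod_cast hne.card_ne_zero
  rw [MonoidAlgebra.uniform, map_smul, LinearMap.smul_apply, algKoopman_indicator,
    inner_smul_left, sum_inner]
  simp only [inner_koopman_const, Finset.sum_const, nsmul_eq_mul, RCLike.conj_to_real]
  rw [inv_mul_cancel_left₀ hE]

/-- The discrepancy bounds the operator `f ↦ |E|⁻¹ ∑ f ∘ T γ - ∫ f` on real functions. Symmetry of
`E` accounts for the inverse in the definition of the Koopman representation. -/
theorem norm_algKoopman_sub_le_discrepancy [IsProbabilityMeasure ν]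
    (hT : IsMeasurePreservingAction ν T) {E : Finset Γ} (hE : ∀ g ∈ E, g⁻¹ ∈ E)
    (htop : discrepancy ν T E ≠ ∞) (f : Lp ℝ 2 ν) :
    ‖hT.algKoopman (MonoidAlgebra.uniform E) f - (∫ x, f x ∂ν) • Lp.const 2 ν (1 : ℝ)‖
      ≤ (discrepancy ν T E).toReal * ‖f‖ := by
  wlog hf : ‖f‖ = 1 generalizing f
  · rcases eq_or_ne f 0 with rfl | h0
    · simp
    have hn : ‖f‖ ≠ 0 := norm_ne_zero_iff.2 h0
    have := this (‖f‖⁻¹ • f) (by rw [norm_smul, norm_inv, norm_norm, inv_mul_cancel₀ hn])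
    rw [← inner_const, inner_smul_left, map_smul, RCLike.conj_to_real, mul_smul, ← smul_sub,
      norm_smul, norm_smul, norm_inv, norm_norm, inner_const, mul_left_comm] at this
    exact le_of_mul_le_mul_left this (inv_pos.2 (norm_pos_iff.2 h0))
  rw [hf, mul_one, Lp.norm_def]
  refine ENNReal.toReal_mono htop ?_
  have hmem : (fun x => ((f x : ℝ) : ℂ)) ∈
      {f : X → ℂ | MemLp f 2 ν ∧ eLpNorm f 2 ν = 1} := by
    refine ⟨(Lp.memLp f).ofReal, ?_⟩
    rw [eLpNorm_congr_norm_ae (g := f) (.of_forall fun x => by simp)]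
    rw [Lp.norm_def, ENNReal.toReal_eq_one_iff] at hf
    exact hf
  refine le_trans (le_of_eq ?_) (le_iSup₂ (f := fun (f : X → ℂ) _ =>
    eLpNorm (fun x => (1 / (E.card : ℂ)) * ∑ γ ∈ E, f (T γ x) - ∫ y, f y ∂ν) 2 ν) _ hmem)
  refine eLpNorm_congr_norm_ae ?_
  have hsum : (hT.algKoopman (MonoidAlgebra.uniform E) f : X → ℝ) =ᵐ[ν]
      fun x => (E.card : ℝ)⁻¹ * ∑ γ ∈ E, f (T γ x) := by
    rw [MonoidAlgebra.uniform, map_smul, LinearMap.smul_apply, algKoopman_indicator]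
    have h1 : ∀ᵐ x ∂ν, ∀ g ∈ E, hT.koopman g f x = f (T g⁻¹ x) :=
      (Filter.eventually_all_finset E).2 fun g _ => hT.coeFn_koopman g f
    filter_upwards [Lp.coeFn_smul (E.card : ℝ)⁻¹ (∑ g ∈ E, hT.koopman g f),
      Lp.coeFn_finsetSum E (fun g => hT.koopman g f), h1] with x hx hx' hx''
    rw [hx, Pi.smul_apply, hx', smul_eq_mul, Finset.sum_apply, Finset.sum_congr rfl hx'']
    congr 1
    exact Finset.sum_nbij' (·⁻¹) (·⁻¹) hE hE (by simp) (by simp) (by simp)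
  filter_upwards [hsum, Lp.coeFn_const (p := 2) (μ := ν) (1 : ℝ),
    Lp.coeFn_smul (∫ x, f x ∂ν) (Lp.const 2 ν (1 : ℝ)),
    Lp.coeFn_sub (hT.algKoopman (MonoidAlgebra.uniform E) f) ((∫ x, f x ∂ν) • Lp.const 2 ν (1 : ℝ))]
    with x h1 h2 h3 h4
  rw [h4, Pi.sub_apply, h1, h3, Pi.smul_apply, h2, integral_complex_ofReal, ← Complex.norm_real]
  simp

/-- On functions of mean zero the averaging operator has norm at most the discrepancy, and it
preserves mean zero, so the bound can be iterated. -/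
theorem algKoopman_uniform_pow_of_inner_const_eq_zero [IsProbabilityMeasure ν]
    (hT : IsMeasurePreservingAction ν T) {E : Finset Γ} (hE : ∀ g ∈ E, g⁻¹ ∈ E)
    (hne : E.Nonempty) (htop : discrepancy ν T E ≠ ∞) {f : Lp ℝ 2 ν}
    (hf : (inner ℝ f (Lp.const 2 ν (1 : ℝ)) : ℝ) = 0) (m : ℕ) :
    (inner ℝ ((hT.algKoopman (MonoidAlgebra.uniform E) ^ m) f) (Lp.const 2 ν (1 : ℝ)) : ℝ) = 0 ∧
      ‖(hT.algKoopman (MonoidAlgebra.uniform E) ^ m) f‖ ≤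
        (discrepancy ν T E).toReal ^ m * ‖f‖ := by
  induction m with
  | zero => simp [hf]
  | succ m ih =>
    rw [pow_succ', Module.End.mul_apply]
    refine ⟨(hT.inner_algKoopman_uniform_const hne _).trans ih.1, ?_⟩
    have := hT.norm_algKoopman_sub_le_discrepancy hE htop
      ((hT.algKoopman (MonoidAlgebra.uniform E) ^ m) f)
    rw [← inner_const, ih.1, zero_smul, sub_zero] at this
    refine this.trans ?_
    rw [pow_succ', mul_assoc]
    exact mul_le_mul_of_nonneg_left ih.2 ENNReal.toReal_nonneg

/-- The moments of the uniform measure on `E` in `ℓ²(Γ)` grow at most like the powers of the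
discrepancy. They are compared with those of the mean-zero part of the function obtained from
`1_A`, where `ν(A)` tends to `0`: its mean is of the order of `ν(A)`, so that projecting it away
changes a quantity of the order of `ν(A)` by at most a multiple of `ν(A)²`. -/
theorem exists_forall_pairing_pow_le [IsProbabilityMeasure ν] (hν : IsAtomless ν)
    (hT : IsMeasurePreservingAction ν T) {E : Finset Γ} (hE : ∀ g ∈ E, g⁻¹ ∈ E)
    (hne : E.Nonempty) (htop : discrepancy ν T E ≠ ∞) {x : MonoidAlgebra ℝ Γ}
    (hx : ∀ g, 0 ≤ x.coeff g) : ∃ K : ℝ, ∀ m : ℕ,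
      MonoidAlgebra.pairing (MonoidAlgebra.uniform E ^ m * x) x ≤
        K * (discrepancy ν T E).toReal ^ m := by
  set D := (discrepancy ν T E).toReal
  set K := x.coeff.sum fun _ a => |a| with hK
  have hK0 : 0 ≤ K := Finset.sum_nonneg fun _ _ => abs_nonneg _
  have hD0 : 0 ≤ D := ENNReal.toReal_nonneg
  set e := Lp.const 2 ν (1 : ℝ) with he
  set P := hT.algKoopman (MonoidAlgebra.uniform E) with hP
  have he1 : (inner ℝ e e : ℝ) = 1 := by
    rw [he, inner_const, integral_congr_ae (Lp.coeFn_const (p := 2) (μ := ν) (1 : ℝ))]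
    simp
  refine ⟨K ^ 2, fun m => ?_⟩
  have main : ∀ A : Set X, MeasurableSet A → 0 < ν A →
      MonoidAlgebra.pairing (MonoidAlgebra.uniform E ^ m * x) x ≤
        K ^ 2 * D ^ m + K ^ 2 * ν.real A := by
    intro A hA hpos
    have hpos' : 0 < ν.real A := ENNReal.toReal_pos hpos.ne' (measure_ne_top ν A)
    set v := indicatorConstLp 2 hA (measure_ne_top ν A) (1 : ℝ) with hv
    set f := hT.algKoopman x v with hf
    have hvnorm : ‖v‖ ^ 2 = ν.real A := by
      rw [← real_inner_self_eq_norm_sq, hv, inner_indicator_self]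
    have hfnorm : ‖f‖ ^ 2 ≤ K ^ 2 * ν.real A := by
      rw [← hvnorm, ← mul_pow]
      gcongr
      exact hT.norm_algKoopman_le x v
    have hlow := hT.pairing_le_inner_algKoopman hA (measure_ne_top ν A)
      (MonoidAlgebra.coeff_uniform_pow_mul_nonneg E hx m) hx
    rw [_root_.map_mul hT.algKoopman, map_pow hT.algKoopman, Module.End.mul_apply,
      ← hP, ← hv, ← hf] at hlow
    set c : ℝ := inner ℝ f e with hc
    have hve : (inner ℝ v e : ℝ) = ν.real A := by
      rw [he, inner_const, hv, integral_indicatorConstLp]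
      simp
    have hcabs : |c| ≤ K * ν.real A := by
      rw [hc, hf, algKoopman_apply, Finsupp.sum, sum_inner, hK, Finsupp.sum, Finset.sum_mul]
      refine (Finset.abs_sum_le_sum_abs _ _).trans (Finset.sum_le_sum fun g _ => ?_)
      rw [inner_smul_left, inner_koopman_const, ← he, hve, abs_mul, abs_of_pos hpos']
      simp
    have hPme : (P ^ m) e = e := by
      rw [Module.End.pow_apply]
      exact Function.iterate_fixed (hT.algKoopman_uniform_const hne) m
    have hf0 : (inner ℝ (f - c • e) e : ℝ) = 0 := by
      rw [inner_sub_left, inner_smul_left, he1, ← hc]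
      simp
    -- `w` is the part of `f` of mean zero.
    obtain ⟨w, hw⟩ : ∃ w, w = f - c • e := ⟨_, rfl⟩
    rw [← hw] at hf0
    have hfw : f = w + c • e := by rw [hw, sub_add_cancel]
    have hw0 : (inner ℝ e w : ℝ) = 0 := by rw [real_inner_comm, hf0]
    obtain ⟨h1, h2⟩ := hT.algKoopman_uniform_pow_of_inner_const_eq_zero hE hne htop hf0 m
    rw [← hP, ← he] at h1
    have hexp : (inner ℝ ((P ^ m) f) f : ℝ) = inner ℝ ((P ^ m) w) w + c ^ 2 := by
      rw [hfw, map_add, map_smul, hPme]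
      simp only [inner_add_left, inner_add_right, inner_smul_left, inner_smul_right, h1, hw0, he1,
        RCLike.conj_to_real]
      ring
    have hnorm0 : ‖w‖ ^ 2 ≤ ‖f‖ ^ 2 := by
      rw [← real_inner_self_eq_norm_sq f, hfw]
      simp only [inner_add_left, inner_add_right, inner_smul_left, inner_smul_right, hf0, hw0, he1,
        RCLike.conj_to_real, real_inner_self_eq_norm_sq]
      nlinarith [sq_nonneg c]
    have hcs : (inner ℝ ((P ^ m) w) w : ℝ) ≤ D ^ m * (K ^ 2 * ν.real A) := by
      calc _ ≤ ‖(P ^ m) w‖ * ‖w‖ := real_inner_le_norm _ _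
        _ ≤ (D ^ m * ‖w‖) * ‖w‖ := by gcongr
        _ = D ^ m * ‖w‖ ^ 2 := by ring
        _ ≤ _ := by gcongr; exact hnorm0.trans hfnorm
    have hc2 : c ^ 2 ≤ (K * ν.real A) ^ 2 := sq_le_sq' (abs_le.1 hcabs).1 (abs_le.1 hcabs).2
    refine le_of_mul_le_mul_left ?_ hpos'
    calc _ ≤ _ := hlow
      _ ≤ D ^ m * (K ^ 2 * ν.real A) + (K * ν.real A) ^ 2 := by rw [hexp]; gcongr
      _ = _ := by ring
  refine le_of_forall_pos_lt_add fun ε hε => ?_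
  obtain ⟨A, hA, hpos, hlt⟩ := hν.exists_measure_lt (ε := ENNReal.ofReal (ε / (K ^ 2 + 1)))
    (by simpa using by positivity)
  have hlt' : ν.real A < ε / (K ^ 2 + 1) := by
    rw [← ENNReal.toReal_ofReal (show 0 ≤ ε / (K ^ 2 + 1) by positivity)]
    exact ENNReal.toReal_strict_mono ENNReal.ofReal_ne_top hlt
  rw [lt_div_iff₀ (by positivity)] at hlt'
  have h0 : 0 < ν.real A := ENNReal.toReal_pos hpos.ne' (measure_ne_top ν A)
  have := main A hA hpos
  nlinarith

/-- A lower bound for the supremum of the Rayleigh quotients of the uniform measure on `E` at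
non-negative finitely supported functions is a lower bound for the discrepancy of `E`. -/
theorem ofReal_le_discrepancy [IsProbabilityMeasure ν] (hν : IsAtomless ν)
    (hT : IsMeasurePreservingAction ν T) {E : Finset Γ} (hE : ∀ g ∈ E, g⁻¹ ∈ E)
    (hne : E.Nonempty) {s : ℝ}
    (hs : ∀ D : ℝ, 0 ≤ D → (∀ x : MonoidAlgebra ℝ Γ, (∀ g, 0 ≤ x.coeff g) →
      MonoidAlgebra.pairing (MonoidAlgebra.indicator E * x) x ≤
        D * E.card * MonoidAlgebra.pairing x x) → s ≤ D) :
    ENNReal.ofReal s ≤ discrepancy ν T E := by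
  -- The bound is trivial if the supremum is infinite; otherwise it can be handled as a real number.
  by_cases htop : discrepancy ν T E = ∞
  · simp [htop]
  have hEpos : (0 : ℝ) < E.card := by exact_mod_cast hne.card_pos
  refine ENNReal.ofReal_le_of_le_toReal (hs _ ENNReal.toReal_nonneg fun x hx => ?_)
  obtain ⟨K, hK⟩ := hT.exists_forall_pairing_pow_le hν hE hne htop hx
  have := MonoidAlgebra.pairing_mul_le_of_forall_pow ENNReal.toReal_nonneg
    (fun y z => by simp [MonoidAlgebra.uniform, MonoidAlgebra.pairing_indicator_mul hE]) hK
  rw [MonoidAlgebra.uniform, smul_mul_assoc, map_smul, LinearMap.smul_apply, smul_eq_mul,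
    inv_mul_le_iff₀ hEpos] at this
  linarith

end IsMeasurePreservingAction

/-! ### Spheres in a free group -/

namespace FreeGroup

variable {α : Type*} [DecidableEq α]

/-- Multiplication by the inverse of a letter shortens a reduced word beginning with that letter and
lengthens any other one. -/
theorem norm_inv_mk_singleton_mul (p : α × Bool) (w : FreeGroup α) :
    ((FreeGroup.mk [p])⁻¹ * w).norm =
      if w.toWord.head? = some p then w.norm - 1 else w.norm + 1 := by
  have h : ((FreeGroup.mk [p])⁻¹ * w).toWord = reduce ((p.1, !p.2) :: w.toWord) := by
    conv_lhs => rw [← mk_toWord (x := w), inv_mk, mul_mk, toWord_mk]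
    rfl
  rw [norm, h, reduce.cons, reduce_toWord, norm]
  rcases w.toWord with _ | ⟨hd, tl⟩
  · simp
  · by_cases hp : hd = p
    · subst hp
      simp
    · have : ¬ (p.1 = hd.1 ∧ p.2 = hd.2) := fun h => hp (Prod.ext h.1.symm h.2.symm)
      simp [hp, this]

/-- In the Cayley tree a vertex other than the root has one neighbour closer to the root, and all
the others are farther away. -/
theorem sum_norm_inv_mk_singleton_mul [Fintype α] (c : ℕ → ℝ) (w : FreeGroup α) :
    ∑ p : α × Bool, c ((FreeGroup.mk [p])⁻¹ * w).norm =
      if w.norm = 0 then 2 * (Fintype.card α : ℝ) * c 1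
      else c (w.norm - 1) + (2 * (Fintype.card α : ℝ) - 1) * c (w.norm + 1) := by
  simp only [norm_inv_mk_singleton_mul, apply_ite c]
  rw [norm]
  rcases w.toWord with _ | ⟨hd, tl⟩
  · simp [mul_comm]
  · simp only [List.head?_cons, Option.some_inj, List.length_cons]
    rw [← Finset.add_sum_erase _ _ (Finset.mem_univ hd), if_pos rfl,
      Finset.sum_congr rfl fun p hp => if_neg (Finset.ne_of_mem_erase hp).symm, Finset.sum_const,
      Finset.card_erase_of_mem (Finset.mem_univ hd), Finset.card_univ, nsmul_eq_mul,
      Nat.cast_pred (Fintype.card_pos_iff.2 ⟨hd⟩)]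
    simp [mul_comm]

end FreeGroup

namespace FreeGroupBasis

variable {Γ : Type*} [Group Γ] {r : ℕ} (a : FreeGroupBasis (Fin r) Γ)

theorem repr_symm_mk_singleton_mem (p : Fin r × Bool) :
    a.repr.symm (FreeGroup.mk [p]) ∈ symmGenerators a := by
  obtain ⟨i, b⟩ := p
  cases b
  · refine Or.inr ⟨i, ?_⟩
    change (a.repr.symm (FreeGroup.of i))⁻¹ = _
    rw [← map_inv]
    rfl
  · exact Or.inl ⟨i, rfl⟩

theorem norm_repr_of_mem {s : Γ} (hs : s ∈ symmGenerators a) : (a.repr s).norm = 1 := by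
  rcases hs with ⟨i, rfl⟩ | ⟨i, rfl⟩ <;> simp

theorem wordLength_eq (g : Γ) : wordLength (symmGenerators a) g = (a.repr g).norm := by
  apply le_antisymm
  · have h : ∀ L : List (Fin r × Bool),
        (L.map fun p => a.repr.symm (FreeGroup.mk [p])).prod = a.repr.symm (FreeGroup.mk L) := by
      intro L
      induction L with
      | nil => simp [← FreeGroup.one_eq_mk]
      | cons p L ih => rw [List.map_cons, List.prod_cons, ih, ← map_mul, FreeGroup.mul_mk]; rfl
    have hmem : (a.repr g).toWord.map (fun p => a.repr.symm (FreeGroup.mk [p])) ∈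
        {l : List Γ | (∀ s ∈ l, s ∈ symmGenerators a) ∧ l.prod = g} := by
      constructor
      · simp only [List.mem_map]
        rintro _ ⟨p, -, rfl⟩
        exact a.repr_symm_mk_singleton_mem p
      · rw [h, FreeGroup.mk_toWord, MulEquiv.symm_apply_apply]
    refine (iInf₂_le _ hmem).trans ?_
    rw [List.length_map]
    rfl
  · refine le_iInf₂ ?_
    rintro l ⟨hl, rfl⟩
    rw [Nat.cast_le]
    induction l with
    | nil => simp
    | cons s l ih =>
      rw [List.prod_cons, map_mul, List.length_cons, add_comm]
      refine (FreeGroup.norm_mul_le _ _).trans (add_le_add ?_ ?_)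
      · exact (a.norm_repr_of_mem (hl s (by simp))).le
      · exact ih fun s hs => hl s (by simp [hs])

theorem mem_freeSphere {n : ℕ} {g : Γ} : g ∈ freeSphere a n ↔ (a.repr g).norm = n := by
  simp [freeSphere, wordSphere, wordLength_eq]

theorem mem_freeBall {n : ℕ} {g : Γ} : g ∈ freeBall a n ↔ (a.repr g).norm ≤ n := by
  simp [freeBall, wordBall, wordLength_eq]

theorem inv_mem_freeSphere {n : ℕ} : ∀ g ∈ freeSphere a n, g⁻¹ ∈ freeSphere a n := by
  simp [mem_freeSphere]

theorem inv_mem_freeBall {n : ℕ} : ∀ g ∈ freeBall a n, g⁻¹ ∈ freeBall a n := by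
  simp [mem_freeBall]

/-- The indicator function of the sphere of radius `n`, as an element of the group algebra. -/
noncomputable def sphereElt (n : ℕ) : MonoidAlgebra ℝ Γ := MonoidAlgebra.indicator (freeSphere a n)

theorem coeff_sphereElt (n : ℕ) (g : Γ) :
    (a.sphereElt n).coeff g = if (a.repr g).norm = n then 1 else 0 := by
  classical
  simp [sphereElt, MonoidAlgebra.coeff_indicator, mem_freeSphere]

theorem sphereElt_zero : a.sphereElt 0 = 1 := by
  classical
  ext g
  simp [coeff_sphereElt, MonoidAlgebra.one_def, Finsupp.single_apply, @eq_comm _ 1 g]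

theorem sphereElt_one :
    a.sphereElt 1 =
      ∑ p : Fin r × Bool, MonoidAlgebra.single (a.repr.symm (FreeGroup.mk [p])) 1 := by
  classical
  have himg : freeSphere a 1 =
      Finset.univ.image fun p : Fin r × Bool => a.repr.symm (FreeGroup.mk [p]) := by
    ext g
    simp only [mem_freeSphere, Finset.mem_image, Finset.mem_univ, true_and]
    constructor
    · intro h
      obtain ⟨p, hp⟩ := List.length_eq_one_iff.1 h
      exact ⟨p, by rw [← hp, FreeGroup.mk_toWord, MulEquiv.symm_apply_apply]⟩
    · rintro ⟨p, rfl⟩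
      rw [MulEquiv.apply_symm_apply, FreeGroup.norm, FreeGroup.toWord_mk,
        FreeGroup.reduce_singleton, List.length_singleton]
  rw [sphereElt, MonoidAlgebra.indicator, himg, Finset.sum_image]
  intro p _ p' _ h
  have := congrArg FreeGroup.toWord (a.repr.symm.injective h)
  simpa only [FreeGroup.toWord_mk, FreeGroup.reduce_singleton, List.cons.injEq, and_true] using this

theorem coeff_sphereElt_one_mul (n : ℕ) (g : Γ) :
    (a.sphereElt 1 * a.sphereElt n).coeff g =
      if (a.repr g).norm = 0 then 2 * (r : ℝ) * (if 1 = n then 1 else 0)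
      else (if (a.repr g).norm - 1 = n then 1 else 0) +
        (2 * (r : ℝ) - 1) * (if (a.repr g).norm + 1 = n then 1 else 0) := by
  have h := FreeGroup.sum_norm_inv_mk_singleton_mul (fun k => if k = n then (1 : ℝ) else 0)
    (a.repr g)
  rw [Fintype.card_fin] at h
  rw [← h, sphereElt_one, Finset.sum_mul, MonoidAlgebra.coeff_sum, Finsupp.finsetSum_apply]
  refine Finset.sum_congr rfl fun p _ => ?_
  rw [MonoidAlgebra.coeff_single_mul_apply, one_mul, coeff_sphereElt, map_mul, map_inv,
    MulEquiv.apply_symm_apply]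

theorem sphereElt_one_mul_one : a.sphereElt 1 * a.sphereElt 1 =
    a.sphereElt 2 + (2 * (r : ℝ)) • a.sphereElt 0 := by
  ext g
  rw [coeff_sphereElt_one_mul, MonoidAlgebra.coeff_add, MonoidAlgebra.coeff_smul, Finsupp.add_apply,
    Finsupp.smul_apply, coeff_sphereElt, coeff_sphereElt]
  generalize (a.repr g).norm = k
  rcases k with _ | _ | k
  · simp
  · simp
  · simp

theorem sphereElt_one_mul_add_two (n : ℕ) : a.sphereElt 1 * a.sphereElt (n + 2) =
    a.sphereElt (n + 3) + (2 * (r : ℝ) - 1) • a.sphereElt (n + 1) := by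
  ext g
  rw [coeff_sphereElt_one_mul, MonoidAlgebra.coeff_add, MonoidAlgebra.coeff_smul, Finsupp.add_apply,
    Finsupp.smul_apply, coeff_sphereElt, coeff_sphereElt]
  generalize (a.repr g).norm = k
  rcases k with _ | k
  · simp
  · simp

theorem card_freeSphere_zero : (freeSphere a 0).card = 1 := by
  have : freeSphere a 0 = {1} := by ext g; simp [mem_freeSphere]
  rw [this, Finset.card_singleton]

theorem card_freeSphere_succ (n : ℕ) :
    ((freeSphere a (n + 1)).card : ℝ) = 2 * (r : ℝ) * (2 * (r : ℝ) - 1) ^ n := by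
  -- The augmentation counts elements, so it carries the recursion for spheres to their sizes.
  let aug := MonoidAlgebra.lift ℝ ℝ Γ (1 : Γ →* ℝ)
  have haug : ∀ n, aug (a.sphereElt n) = (freeSphere a n).card := fun n => by
    simp [aug, sphereElt, MonoidAlgebra.indicator]
  have h1 : ((freeSphere a 1).card : ℝ) = 2 * r := by
    rw [← haug, sphereElt_one]
    simp [aug, mul_comm]
  have h2 := congrArg aug a.sphereElt_one_mul_one
  simp only [map_mul, map_add, map_smul, haug, h1, card_freeSphere_zero, smul_eq_mul] at h2
  induction n using Nat.twoStepInduction with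
  | zero => simp [h1]
  | one => push_cast at h2; linarith
  | more n ih1 ih2 =>
    have h3 := congrArg aug (a.sphereElt_one_mul_add_two n)
    simp only [map_mul, map_add, map_smul, haug, h1, ih1, ih2, smul_eq_mul] at h3
    rw [pow_succ] at h3
    rw [pow_succ, pow_succ]
    linarith

theorem indicator_freeBall (n : ℕ) :
    MonoidAlgebra.indicator (freeBall a n) = ∑ k ∈ Finset.range (n + 1), a.sphereElt k := by
  classical
  ext g
  simp [MonoidAlgebra.coeff_indicator, mem_freeBall, coeff_sphereElt]

theorem card_freeBall (n : ℕ) :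
    (freeBall a n).card = ∑ k ∈ Finset.range (n + 1), (freeSphere a k).card := by
  classical
  rw [← Finset.card_biUnion]
  · congr 1
    ext g
    simp [mem_freeBall, mem_freeSphere]
  · intro j _ k _ hjk
    refine Finset.disjoint_left.2 fun g hj hk => hjk ?_
    rw [← a.mem_freeSphere.1 hj, a.mem_freeSphere.1 hk]

end FreeGroupBasis

/-! ### Approximate eigenfunctions of the spheres -/

namespace MonoidAlgebra

/-- The sequences of finitely supported functions that are bounded in `ℓ²(Γ)`. -/
def bounded (Γ : Type*) : Submodule ℝ (ℕ → MonoidAlgebra ℝ Γ) where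
  carrier := {e | ∃ C : ℝ, ∀ N, pairing (e N) (e N) ≤ C}
  zero_mem' := ⟨0, fun N => by simp⟩
  add_mem' := by
    rintro e f ⟨C, hC⟩ ⟨C', hC'⟩
    refine ⟨2 * C + 2 * C', fun N => ?_⟩
    have h := pairing_self_nonneg (e N - f N)
    simp only [map_sub, LinearMap.sub_apply] at h
    simp only [Pi.add_apply, map_add, LinearMap.add_apply]
    linarith [hC N, hC' N]
  smul_mem' := by
    rintro c e ⟨C, hC⟩
    refine ⟨c ^ 2 * C, fun N => ?_⟩
    simp only [Pi.smul_apply, map_smul, LinearMap.smul_apply, smul_eq_mul, ← mul_assoc, ← sq]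
    exact mul_le_mul_of_nonneg_left (hC N) (sq_nonneg c)

variable {Γ : Type*} [Group Γ]

theorem mul_mem_bounded (x : MonoidAlgebra ℝ Γ) {e : ℕ → MonoidAlgebra ℝ Γ}
    (he : e ∈ bounded Γ) : (fun N => x * e N) ∈ bounded Γ := by
  induction x using MonoidAlgebra.induction_linear with
  | zero => simp only [zero_mul]; exact (bounded Γ).zero_mem
  | add x y hx hy => simp only [add_mul]; exact (bounded Γ).add_mem hx hy
  | single g c =>
    obtain ⟨C, hC⟩ := he
    refine ⟨c ^ 2 * C, fun N => ?_⟩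
    have h : single g⁻¹ c * (single g c * e N) = c ^ 2 • e N := by
      rw [← mul_assoc, single_mul_single, inv_mul_cancel, ← sq, ← smul_one_mul (c ^ 2) (e N),
        one_def, smul_single', mul_one]
    rw [pairing_single_mul, h, map_smul, smul_eq_mul]
    exact mul_le_mul_of_nonneg_left (hC N) (sq_nonneg c)

/-- If `g N` tends to infinity in `ℓ²(Γ)` and `u * g N - s • g N` is bounded, the Rayleigh quotients
of `u` at `g N` tend to `s`, so every upper bound of them is at least `s`. -/
theorem le_of_pairing_mul_le {u : MonoidAlgebra ℝ Γ} {g : ℕ → MonoidAlgebra ℝ Γ} {s D : ℝ}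
    (hg : ∀ N : ℕ, (N : ℝ) ≤ pairing (g N) (g N))
    (hs : (fun N => u * g N - s • g N) ∈ bounded Γ)
    (hD : ∀ N, pairing (u * g N) (g N) ≤ D * pairing (g N) (g N)) : s ≤ D := by
  by_contra! hlt
  obtain ⟨C, hC⟩ := hs
  have hpos : 0 < (s - D) ^ 2 := pow_pos (sub_pos.2 hlt) 2
  obtain ⟨N, hN⟩ := exists_nat_gt (max (C / (s - D) ^ 2) 0)
  have hgN : 0 < pairing (g N) (g N) := ((le_max_right _ _).trans_lt hN).trans_le (hg N)
  have h1 : C < (s - D) ^ 2 * pairing (g N) (g N) := by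
    rw [← div_lt_iff₀' hpos]
    exact ((le_max_left _ _).trans_lt hN).trans_le (hg N)
  have h2 : (s - D) * pairing (g N) (g N) ≤ -pairing (u * g N - s • g N) (g N) := by
    simp only [map_sub, map_smul, LinearMap.sub_apply, LinearMap.smul_apply, smul_eq_mul]
    linarith [hD N]
  have h3 := pairing_sq_le (u * g N - s • g N) (g N)
  have h4 : ((s - D) * pairing (g N) (g N)) ^ 2 ≤ pairing (u * g N - s • g N) (g N) ^ 2 := by
    rw [← neg_sq (pairing (u * g N - s • g N) (g N))]
    exact pow_le_pow_left₀ (mul_nonneg (sub_pos.2 hlt).le hgN.le) h2 2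
  have h5 : ((s - D) * pairing (g N) (g N)) ^ 2 ≤ C * pairing (g N) (g N) :=
    (h4.trans h3).trans (mul_le_mul_of_nonneg_right (hC N) hgN.le)
  nlinarith

end MonoidAlgebra

namespace FreeGroupBasis

open MonoidAlgebra

variable {Γ : Type*} [Group Γ] {r : ℕ} (a : FreeGroupBasis (Fin r) Γ)

/-- The truncation to radius `N + 1` of the radial function `γ ↦ t ^ (-|γ|)`. For `t = √q` this
function fails to be in `ℓ²(Γ)` only just: every sphere contributes about the same amount. The
radius is at least `1`, so that the truncation never interferes with the value at the identity. -/
noncomputable def testElt (t : ℝ) (N : ℕ) : MonoidAlgebra ℝ Γ :=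
  ∑ k ∈ Finset.range (N + 2), (t ^ k)⁻¹ • a.sphereElt k

theorem coeff_testElt_nonneg {t : ℝ} (ht : 0 ≤ t) (N : ℕ) (g : Γ) :
    0 ≤ (a.testElt t N).coeff g := by
  rw [testElt, coeff_sum, Finsupp.finsetSum_apply]
  refine Finset.sum_nonneg fun k _ => ?_
  rw [coeff_smul, Finsupp.smul_apply, coeff_sphereElt]
  split_ifs <;> simp [ht]

theorem pairing_sphereElt_self (n : ℕ) :
    pairing (a.sphereElt n) (a.sphereElt n) = (freeSphere a n).card := by
  rw [sphereElt, pairing_indicator_left, ← sphereElt,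
    Finset.sum_congr rfl fun g hg => by rw [coeff_sphereElt, if_pos (a.mem_freeSphere.1 hg)]]
  simp

theorem le_pairing_testElt (hr : 1 ≤ r) {t : ℝ} (ht : 0 < t) (htr : t ^ 2 = 2 * (r : ℝ) - 1)
    (N : ℕ) : (N : ℝ) ≤ pairing (a.testElt t N) (a.testElt t N) := by
  -- Spheres contribute `1` for `k = 0` and `(q + 1) / q` otherwise.
  have hstep : ∀ k, 1 ≤ pairing ((t ^ k)⁻¹ • a.sphereElt k) ((t ^ k)⁻¹ • a.sphereElt k) := by
    intro k
    simp only [map_smul, LinearMap.smul_apply, smul_eq_mul, pairing_sphereElt_self]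
    rcases k with _ | k
    · simp [card_freeSphere_zero]
    · rw [card_freeSphere_succ, ← htr]
      have : (t ^ (k + 1))⁻¹ * ((t ^ (k + 1))⁻¹ * (2 * r * (t ^ 2) ^ k)) = 2 * r / t ^ 2 := by
        field_simp
        ring
      rw [this, le_div_iff₀ (pow_pos ht 2)]
      linarith
  have hnn : ∀ k N, 0 ≤ pairing ((t ^ k)⁻¹ • a.sphereElt k) (a.testElt t N) := by
    intro k N
    rw [map_smul, LinearMap.smul_apply, sphereElt, pairing_indicator_left]
    exact smul_nonneg (by positivity)
      (Finset.sum_nonneg fun g _ => a.coeff_testElt_nonneg ht.le N g)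
  induction N with
  | zero => simpa using pairing_self_nonneg _
  | succ N ih =>
    have hrec : a.testElt t (N + 1) = a.testElt t N + (t ^ (N + 2))⁻¹ • a.sphereElt (N + 2) := by
      rw [testElt, Finset.sum_range_succ, ← testElt]
    simp only [hrec, map_add, LinearMap.add_apply]
    rw [pairing_comm (a.testElt t N) (_ • _)]
    push_cast
    linarith [hstep (N + 2), hnn (N + 2) N]

/-- The test functions are eigenfunctions of the sphere of radius `1` with eigenvalue `2 √q`, up to
errors at the identity and at the boundary. -/
theorem sphereElt_one_mul_testElt {t : ℝ} (ht : 0 < t) (htr : t ^ 2 = 2 * (r : ℝ) - 1) (N : ℕ) :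
    a.sphereElt 1 * a.testElt t N = (2 * t) • a.testElt t N + (t⁻¹ - t) • a.sphereElt 0
      - t • (t ^ (N + 1))⁻¹ • a.sphereElt (N + 1) + t • (t ^ (N + 2))⁻¹ • a.sphereElt (N + 2) := by
  have h2r : 2 * (r : ℝ) = t ^ 2 + 1 := by linarith
  induction N with
  | zero =>
    simp only [testElt, Finset.sum_range_succ, Finset.sum_range_zero, zero_add, pow_zero, inv_one,
      one_smul, pow_one, mul_add, mul_smul_comm, sphereElt_one_mul_one, h2r]
    rw [a.sphereElt_zero, mul_one]
    match_scalars <;> field_simp <;> ring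
  | succ N ih =>
    have hrec : a.testElt t (N + 1) = a.testElt t N + (t ^ (N + 2))⁻¹ • a.sphereElt (N + 2) := by
      rw [testElt, Finset.sum_range_succ, ← testElt]
    rw [hrec, mul_add, ih, mul_smul_comm, sphereElt_one_mul_add_two, h2r]
    match_scalars <;> field_simp <;> ring

/-- The boundary errors are bounded in `ℓ²(Γ)`, because a sphere has about `q ^ N` elements. -/
theorem smul_sphereElt_mem_bounded {t : ℝ} (ht : 0 < t) (htr : t ^ 2 = 2 * (r : ℝ) - 1) (m : ℕ) :
    (fun N => (t ^ (N + (m + 1)))⁻¹ • a.sphereElt (N + (m + 1))) ∈ bounded Γ := by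
  refine ⟨2 * r / t ^ 2, fun N => le_of_eq ?_⟩
  simp only [map_smul, LinearMap.smul_apply, smul_eq_mul, pairing_sphereElt_self]
  rw [← add_assoc, card_freeSphere_succ, ← htr]
  field_simp
  ring

/-- The approximate eigenvalue of the sphere of radius `n` at the test functions, where
`q = t ^ 2`. It solves the three-term recursion satisfied by the spheres, with `2 * t` as the
value at `n = 1`. -/
noncomputable def sphereEigenvalue (t : ℝ) : ℕ → ℝ
  | 0 => 1
  | n + 1 => ((n + 2) * t ^ 2 - n) * t ^ (n + 1) / t ^ 2

theorem sphereElt_mul_testElt_mem_bounded {t : ℝ} (ht : 0 < t) (htr : t ^ 2 = 2 * (r : ℝ) - 1)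
    (n : ℕ) : (fun N => a.sphereElt n * a.testElt t N - sphereEigenvalue t n • a.testElt t N) ∈
      bounded Γ := by
  have h2r : 2 * (r : ℝ) = t ^ 2 + 1 := by linarith
  have h1 : (fun N => a.sphereElt 1 * a.testElt t N - (2 * t) • a.testElt t N) ∈ bounded Γ := by
    have hconst : (fun _ : ℕ => a.sphereElt 0) ∈ bounded Γ := ⟨_, fun _ => le_rfl⟩
    convert (bounded Γ).add_mem
      ((bounded Γ).sub_mem ((bounded Γ).smul_mem (t⁻¹ - t) hconst)
        ((bounded Γ).smul_mem t (a.smul_sphereElt_mem_bounded ht htr 0)))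
      ((bounded Γ).smul_mem t (a.smul_sphereElt_mem_bounded ht htr 1)) using 1
    ext1 N
    simp only [Pi.add_apply, Pi.sub_apply, Pi.smul_apply, sphereElt_one_mul_testElt a ht htr]
    abel
  have e1 : sphereEigenvalue t 1 = 2 * t := by
    simp only [sphereEigenvalue]; field_simp; push_cast; ring
  induction n using Nat.strong_induction_on with
  | _ n ih =>
  rcases n with _ | _ | n
  · convert (bounded Γ).zero_mem using 1
    ext1 N
    simp [sphereEigenvalue, sphereElt_zero]
  · rwa [zero_add, e1]
  -- The recursion has the coefficient `q + 1` in its first step and `q` in all later ones.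
  · have key : ∃ c : ℝ, a.sphereElt (n + 2) =
        a.sphereElt 1 * a.sphereElt (n + 1) - c • a.sphereElt n ∧ sphereEigenvalue t (n + 2) =
        2 * t * sphereEigenvalue t (n + 1) - c * sphereEigenvalue t n := by
      rcases n with _ | n
      · refine ⟨2 * r, by rw [zero_add, sphereElt_one_mul_one, add_sub_cancel_right], ?_⟩
        simp only [sphereEigenvalue, h2r]
        field_simp
        push_cast
        ring
      · refine ⟨2 * r - 1, by rw [sphereElt_one_mul_add_two, add_sub_cancel_right], ?_⟩
        simp only [sphereEigenvalue, ← htr]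
        field_simp
        push_cast
        ring
    obtain ⟨c, hc, hc'⟩ := key
    convert (bounded Γ).sub_mem ((bounded Γ).add_mem
      (mul_mem_bounded (a.sphereElt 1) (ih (n + 1) (by omega)))
      ((bounded Γ).smul_mem (sphereEigenvalue t (n + 1)) h1))
      ((bounded Γ).smul_mem c (ih n (by omega))) using 1
    ext1 N
    simp only [Pi.add_apply, Pi.sub_apply, Pi.smul_apply, hc, hc', mul_sub, sub_mul, mul_smul_comm,
      smul_mul_assoc, mul_assoc]
    module

theorem sum_sphereEigenvalue {t : ℝ} (ht : 0 < t) (n : ℕ) :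
    ∑ k ∈ Finset.range (n + 1), sphereEigenvalue t k = (1 + (1 + 1 / t) * n) * t ^ n := by
  induction n with
  | zero => simp [sphereEigenvalue]
  | succ n ih =>
    rw [Finset.sum_range_succ, ih, sphereEigenvalue]
    field_simp
    push_cast
    ring

theorem card_freeBall_eq (n : ℕ) :
    ((freeBall a n).card : ℝ) =
      (2 * r - 1) ^ n + 2 * ∑ k ∈ Finset.range n, (2 * (r : ℝ) - 1) ^ k := by
  rw [card_freeBall]
  push_cast
  induction n with
  | zero => simp [card_freeSphere_zero]
  | succ n ih =>
    rw [Finset.sum_range_succ, ih, card_freeSphere_succ, Finset.sum_range_succ]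
    ring

end FreeGroupBasis

/-! ### The discrepancy of spheres and balls -/

theorem mainTheorem4 {Γ X : Type*} [Group Γ] [MeasurableSpace X]
    (ν : Measure X) [IsProbabilityMeasure ν] (hν : IsAtomless ν)
    (r : ℕ) (hr : 1 ≤ r) (a : FreeGroupBasis (Fin r) Γ)
    (T : Γ → X → X) (hT : IsMeasurePreservingAction ν T)
    (q : ℝ) (hq : q = 2 * (r : ℝ) - 1) (n : ℕ) :
    ENNReal.ofReal ((1 + (q - 1) / (q + 1) * (n : ℝ)) * q ^ (-(n : ℝ) / 2))
        ≤ discrepancy ν T (freeSphere a n) ∧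
      ENNReal.ofReal (ballConst q n * (1 + (1 + 1 / Real.sqrt q) * (n : ℝ)) * q ^ (-(n : ℝ) / 2))
        ≤ discrepancy ν T (freeBall a n) := by
  have hr' : (1 : ℝ) ≤ r := by exact_mod_cast hr
  have hq0 : 0 < q := by linarith
  obtain ⟨t, ht, rfl⟩ : ∃ t : ℝ, 0 < t ∧ q = t ^ 2 :=
    ⟨√q, Real.sqrt_pos.2 hq0, (Real.sq_sqrt hq0.le).symm⟩
  have hrpow : (t ^ 2) ^ (-(n : ℝ) / 2) = (t ^ n)⁻¹ := by
    rw [← Real.rpow_natCast t 2, ← Real.rpow_mul ht.le, ← Real.rpow_natCast t n,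
      ← Real.rpow_neg ht.le]
    congr 1
    push_cast
    ring
  rw [hrpow, Real.sqrt_sq ht.le]
  have hS : (0 : ℝ) < (freeSphere a n).card := by
    rcases n with _ | n
    · simp [FreeGroupBasis.card_freeSphere_zero]
    · rw [FreeGroupBasis.card_freeSphere_succ, ← hq]
      positivity
  -- `c(q, n)` is `q ^ n / |Bₙ|`, so the lower bound for the ball is its eigenvalue divided
  -- by `|Bₙ|`.
  have hB : ((freeBall a n).card : ℝ)⁻¹ = ballConst (t ^ 2) n * ((t ^ 2) ^ n)⁻¹ := by
    rw [a.card_freeBall_eq, ← hq, ballConst, ← mul_inv, zpow_neg, zpow_natCast]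
    congr 1
    field_simp
  have hBpos : (0 : ℝ) < (freeBall a n).card := by
    rw [a.card_freeBall_eq, ← hq]
    positivity
  constructor
  · refine hT.ofReal_le_discrepancy hν a.inv_mem_freeSphere (Finset.card_pos.1 (mod_cast hS))
      fun D _ hD => ?_
    have h := MonoidAlgebra.le_of_pairing_mul_le (a.le_pairing_testElt hr ht hq)
      (a.sphereElt_mul_testElt_mem_bounded ht hq n)
      (fun N => hD _ (a.coeff_testElt_nonneg ht.le N))
    rw [← div_le_iff₀ hS] at h
    refine le_trans (le_of_eq ?_) h
    rcases n with _ | n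
    · simp [FreeGroupBasis.card_freeSphere_zero, FreeGroupBasis.sphereEigenvalue]
    · rw [FreeGroupBasis.card_freeSphere_succ, ← hq, show 2 * (r : ℝ) = t ^ 2 + 1 by linarith,
        FreeGroupBasis.sphereEigenvalue]
      field_simp
      push_cast
      ring
  · refine hT.ofReal_le_discrepancy hν a.inv_mem_freeBall (Finset.card_pos.1 (mod_cast hBpos))
      fun D _ hD => ?_
    have hmem : (fun N => MonoidAlgebra.indicator (freeBall a n) * a.testElt t N -
        ((1 + (1 + 1 / t) * n) * t ^ n) • a.testElt t N) ∈ MonoidAlgebra.bounded Γ := by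
      convert (MonoidAlgebra.bounded Γ).sum_mem (t := Finset.range (n + 1))
        fun k _ => a.sphereElt_mul_testElt_mem_bounded ht hq k using 1
      ext1 N
      rw [a.indicator_freeBall, ← FreeGroupBasis.sum_sphereEigenvalue ht, Finset.sum_apply,
        Finset.sum_sub_distrib, Finset.sum_mul, Finset.sum_smul]
    have h := MonoidAlgebra.le_of_pairing_mul_le (a.le_pairing_testElt hr ht hq) hmem
      (fun N => hD _ (a.coeff_testElt_nonneg ht.le N))
    rw [← div_le_iff₀ hBpos, div_eq_mul_inv, hB] at h
    refine le_trans (le_of_eq ?_) h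
    field_simp
    ring
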